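/- Let $\mathfrak A$ be a countably infinite alphabet of variables and let $\mathfrak A^+$ be the free semigroup of nonempty words over $\mathfrak A$. An island of a word $\mathbf u$ is a maximal subword of consecutive letters of $\mathbf u$ that is a power of a single variable; the height of a word over a two-letter alphabet is the number of its islands. Two words are of the same type if one can be obtained from the other by changing the (positive) exponents of the islands. An identity $\mathbf u\approx\mathbf v$ with $\mathbf u,\mathbf v\in\mathfrak A^+$ is satisfied by a monoid $M$ if $\varphi(\mathbf u)=\varphi(\mathbf v)$ for every semigroup homomorphism $\varphi:\mathfrak A^+\to M$. The monoid $M$ is finitely based if there is a finite set of identities of $M$ from which every identity of $M$ can be deduced (by substituting words of $\mathfrak A^+$ for variables, multiplication, reflexivity, symmetry and transitivity), and non-finitely based otherwise. **Theorem.** Let $M$ be a monoid with Property $(\mathrm C_4)$: whenever $\mathbf u\in\{x,y\}^+$, for distinct variables $x,y$, has height at most $4$ and $M$ satisfies $\mathbf u\approx\mathbf v$ with $\mathbf v\in\mathfrak A^+$, the words $\mathbf u$ and $\mathbf v$ are of the same type. If for every $n>0$ the monoid $M$ satisfies the identity $$(x_1x_2\cdots x_n)(x_nx_{n-1}\cdots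 x_1)(x_1x_2\cdots x_n)\approx(x_1x_2\cdots x_n)(x_1^2x_2^2\cdots x_n^2),$$ where $x_1,x_2,\dots$ are distinct variables, then $M$ is non-finitely based. -/

import Mathlib

namespace MonoidIdentities

/-- The (nonempty) words over a countably infinite alphabet of variables `0, 1, 2, …`. -/
abbrev Word : Type := FreeSemigroup ℕ

/-- The sequence of letters of a word, from left to right. -/
def letters (u : Word) : List ℕ := u.head :: u.tail

/-- The sequence of variables that form the successive islands (maximal blocks of one repeated
variable) of `u`: every island is replaced by a single copy of its variable. -/
def islands (u : Word) : List ℕ := (letters u).destutter (· ≠ ·)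

/-- The height of a word: its number of islands. -/
def height (u : Word) : ℕ := (islands u).length

/-- Two words are of the same type if one is obtained from the other by changing the (positive)
exponents of the islands, i.e. if the same variables form their successive islands. -/
def SameType (u v : Word) : Prop := islands u = islands v

/-- The semigroup `S` satisfies the identity `u ≈ v`. -/
def Satisfies (S : Type*) [Semigroup S] (u v : Word) : Prop :=
  ∀ φ : ℕ → S, FreeSemigroup.lift φ u = FreeSemigroup.lift φ v

/-- Property (C_ℓ): a word of height at most `ℓ` over two variables `x`, `y` forms an identity
of `S` only with words of the same type. -/
def PropertyC (ℓ : ℕ) (S : Type*) [Semigroup S] : Prop :=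
  ∀ x y : ℕ, x ≠ y → ∀ u : Word, (∀ z ∈ letters u, z = x ∨ z = y) → height u ≤ ℓ →
    ∀ v : Word, Satisfies S u v → SameType u v

/-- `Deducible B u v`: the identity `u ≈ v` can be deduced from the set `B` of identities, by
substituting words for variables, multiplication, reflexivity, symmetry and transitivity. -/
inductive Deducible (B : Set (Word × Word)) : Word → Word → Prop
  | subst (u v : Word) (h : (u, v) ∈ B) (θ : ℕ → Word) :
      Deducible B (FreeSemigroup.lift θ u) (FreeSemigroup.lift θ v)
  | refl (u : Word) : Deducible B u u
  | symm {u v : Word} : Deducible B u v → Deducible B v u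
  | trans {u v w : Word} : Deducible B u v → Deducible B v w → Deducible B u w
  | mul {u v u' v' : Word} :
      Deducible B u v → Deducible B u' v' → Deducible B (u * u') (v * v')

/-- `S` is finitely based: all its identities can be deduced from a finite set of them. -/
def FinitelyBased (S : Type*) [Semigroup S] : Prop :=
  ∃ B : Set (Word × Word), B.Finite ∧ (∀ p ∈ B, Satisfies S p.1 p.2) ∧
    ∀ u v : Word, Satisfies S u v → Deducible B u v

/-- The variable `x_{i+1}`; the index is shifted since the alphabet starts with `0`. -/
def var (i : ℕ) : Word := FreeSemigroup.of i

/-- The word `x_1 x_2 ⋯ x_{k+1}`. -/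
def ascending : ℕ → Word
  | 0 => var 0
  | k + 1 => ascending k * var (k + 1)

/-- The word `x_{k+1} ⋯ x_2 x_1`. -/
def descending : ℕ → Word
  | 0 => var 0
  | k + 1 => var (k + 1) * descending k

/-- The word `x_1² x_2² ⋯ x_{k+1}²`. -/
def squares : ℕ → Word
  | 0 => var 0 * var 0
  | k + 1 => squares k * (var (k + 1) * var (k + 1))

/-- The word `U_n = (x_1 ⋯ x_n) (x_n ⋯ x_1) (x_1 ⋯ x_n)` for `n = k + 1`. -/
def wordU (k : ℕ) : Word := ascending k * descending k * ascending k

/-- The word `V_n = (x_1 ⋯ x_n) (x_1² ⋯ x_n²)` for `n = k + 1`. -/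
def wordV (k : ℕ) : Word := ascending k * squares k

end MonoidIdentities

/-!
Words are handled as lists of letters over `0, …, k`, so that `n = k + 1`, and `l ⊑ w` below means
that `l` is a scattered subword (`List.Sublist`) of `w`.

Property `(C₄)` controls the words `w` with `M ⊨ U_n ≈ w`: for `x < y` the islands of `x` and `y` in
`w` are `x, y, x, y`, and the same holds after identifying smaller, or larger, variables with each
other (`IsTyped`, `PropertyC.isTyped`). Such a `w` consists of an ascending part up to the first `k`,
a descending part formed by powers of some of the variables `k - 1, …, 1`, and a final ascending
part. A variable `i` with `0 < i < k` belongs to the descending part exactly if `[k, i, 0] ⊑ w`. In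
`U_n` this holds for all such `i`, in `V_n` for none of them.

The set of words with the full descending part is closed under deductions from identities of `M`
with fewer than `k - 2` variables (`PropertyC.sublist_flatMap`), hence `U_n ≈ V_n` does not follow
from finitely many identities of `M` for all `n`. Let `θ s` have the full descending part, let
`M ⊨ s ≈ t`, and suppose that `i` is lost in `θ t`. By the pigeonhole principle some variable `h` of
`s` covers two letters `l < l'`, both different from `i`, of the descending part. The restrictions on
`θ s` force `h` to be linear in `s`, and `θ h` to contain `l'` to the left of `l`
(`IsTyped.linear_of_covers`). By `(C₄)` the variable `h` is also linear in `t`. Mark the letter `l`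
covered by `h`, and identify it with `0` if `i < l` and with `k` if `l < i`; erase everything except
`i`, the mark and the letter identified with it. In `θ s` the descending part contains `i` as well, to
the right of the mark if `i < l` and to its left if `l < i`; so the mark and the letter identified
with it are separated by `i`, and `i, l, i, l, i` is a scattered subword. In `θ t` nothing separates
them any more: the mark joins an island of that letter, and the height is at most four. This
contradicts `(C₄)` (`PropertyC.sublist_of_linear`).
-/

namespace MonoidIdentities

/-! ### Identities between lists of letters -/

/-- The monoid `M` satisfies the identity `s ≈ t`, whose sides are possibly empty words over an
arbitrary alphabet `V`. -/
def ListIdentity (M : Type*) [Monoid M] {V : Type*} (s t : List V) : Prop :=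
  ∀ φ : V → M, (s.map φ).prod = (t.map φ).prod

lemma letters_mul (u v : Word) : letters (u * v) = letters u ++ letters v := by
  simp [letters]

lemma letters_of (i : ℕ) : letters (FreeSemigroup.of i) = [i] := by
  simp [letters]

lemma lift_eq_prod {M : Type*} [Monoid M] (φ : ℕ → M) (u : Word) :
    FreeSemigroup.lift φ u = ((letters u).map φ).prod := by
  induction u using FreeSemigroup.recOnMul with
  | ih1 x => simp [letters_of]
  | ih2 x y hx hy => rw [map_mul, hx, hy, letters_mul, List.map_append, List.prod_append]

lemma letters_lift (θ : ℕ → Word) (u : Word) :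
    letters (FreeSemigroup.lift θ u) = (letters u).flatMap fun i => letters (θ i) := by
  induction u using FreeSemigroup.recOnMul with
  | ih1 x => simp [letters_of]
  | ih2 x y hx hy => rw [map_mul, letters_mul, hx, hy, letters_mul, List.flatMap_append]

section Identities

variable {M : Type*} [Monoid M] {V W : Type*}

lemma satisfies_iff (u v : Word) :
    Satisfies M u v ↔ ListIdentity M (letters u) (letters v) := by
  simp only [Satisfies, ListIdentity, lift_eq_prod]

lemma prod_map_flatMap (ψ : V → List W) (φ : W → M) (s : List V) :
    ((s.flatMap ψ).map φ).prod = (s.map fun v => ((ψ v).map φ).prod).prod := by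
  induction s with
  | nil => rfl
  | cons a s ih => simp [ih]

namespace ListIdentity

lemma symm {s t : List V} (h : ListIdentity M s t) : ListIdentity M t s := fun φ => (h φ).symm

lemma trans {s t r : List V} (h : ListIdentity M s t) (h' : ListIdentity M t r) :
    ListIdentity M s r := fun φ => (h φ).trans (h' φ)

lemma flatMap {s t : List V} (h : ListIdentity M s t) (ψ : V → List W) :
    ListIdentity M (s.flatMap ψ) (t.flatMap ψ) := fun φ => by
  rw [prod_map_flatMap, prod_map_flatMap]
  exact h _

lemma map {s t : List V} (h : ListIdentity M s t) (f : V → W) :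
    ListIdentity M (s.map f) (t.map f) := fun φ => by
  simpa using h (φ ∘ f)

lemma append {s t s' t' : List V} (h : ListIdentity M s t) (h' : ListIdentity M s' t') :
    ListIdentity M (s ++ s') (t ++ t') := fun φ => by
  simp [h φ, h' φ]

lemma refl (s : List V) : ListIdentity M s s := fun _ => rfl

end ListIdentity

end Identities

/-! ### Alternating scattered subwords and the type of a word -/

/-- A scattered subword without equal neighbours survives when every island is shrunk to one
letter. -/
lemma sublist_destutter' {α : Type*} [DecidableEq α] (l : List α) :
    ∀ (a : α) (p : List α), p.IsChain (· ≠ ·) → p.Sublist (a :: l) →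
      p.Sublist (l.destutter' (· ≠ ·) a) := by
  induction l with
  | nil => intro a p _ h; simpa using h
  | cons b l ih =>
    intro a p hp h
    by_cases hab : a = b
    · subst hab
      rw [List.destutter'_cons_neg _ (by simp)]
      apply ih a p hp
      rcases List.sublist_cons_iff.1 h with h | ⟨r, rfl, hr⟩
      · exact h
      · rcases List.sublist_cons_iff.1 hr with hr | ⟨r', rfl, -⟩
        · exact hr.cons_cons a
        · simp at hp
    · rw [List.destutter'_cons_pos _ hab]
      rcases List.sublist_cons_iff.1 h with h | ⟨r, rfl, hr⟩
      · exact (ih b p hp h).cons a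
      · exact (ih b r hp.tail hr).cons_cons a

lemma sublist_destutter {α : Type*} [DecidableEq α] {l p : List α} (hp : p.IsChain (· ≠ ·))
    (h : p.Sublist l) : p.Sublist (l.destutter (· ≠ ·)) := by
  cases l with
  | nil => simpa using h
  | cons a l => rw [List.destutter_cons']; exact sublist_destutter' l a p hp h

lemma alternating_five {l : List Bool} (hl : l.IsChain (· ≠ ·)) (h : 5 ≤ l.length) :
    [true, false, true, false, true].Sublist l ∨ [false, true, false, true, false].Sublist l := by
  match l, h with
  | a :: b :: c :: d :: e :: l, _ =>
    simp only [List.isChain_cons_cons] at hl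
    revert hl
    cases a <;> cases b <;> cases c <;> cases d <;> cases e <;> simp

/-- A two-letter word whose height is at least five has an alternating scattered subword of
length five. -/
lemma length_destutter_le_four {l : List Bool}
    (h1 : ¬ [true, false, true, false, true].Sublist l)
    (h2 : ¬ [false, true, false, true, false].Sublist l) :
    (l.destutter (· ≠ ·)).length ≤ 4 := by
  by_contra! h
  have hs := List.destutter_sublist (· ≠ ·) l
  rcases alternating_five (List.isChain_destutter _ l) h with h | h
  · exact h1 (h.trans hs)
  · exact h2 (h.trans hs)

lemma destutter'_map {α β : Type*} [DecidableEq α] [DecidableEq β] {f : α → β}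
    (hf : Function.Injective f) (l : List α) : ∀ a,
    (l.map f).destutter' (· ≠ ·) (f a) = (l.destutter' (· ≠ ·) a).map f := by
  induction l with
  | nil => intro a; rfl
  | cons b l ih =>
    intro a
    by_cases hab : a = b
    · subst hab
      rw [List.map_cons, List.destutter'_cons_neg _ (by simp), List.destutter'_cons_neg _ (by simp),
        ih]
    · rw [List.map_cons, List.destutter'_cons_pos _ (hf.ne hab), List.destutter'_cons_pos _ hab,
        ih, List.map_cons]

lemma destutter_map {α β : Type*} [DecidableEq α] [DecidableEq β] {f : α → β}
    (hf : Function.Injective f) (l : List α) :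
    (l.map f).destutter (· ≠ ·) = (l.destutter (· ≠ ·)).map f := by
  cases l with
  | nil => rfl
  | cons a l => exact destutter'_map hf l a

section PropertyC

variable {M : Type*} [Monoid M]

/-- Over a monoid with Property `(C₄)` the empty word forms no nontrivial identity. -/
lemma PropertyC.eq_nil (hC : PropertyC 4 M) {t : List ℕ} (h : ListIdentity M [] t) : t = [] := by
  by_contra ht
  obtain ⟨c, hc⟩ := List.exists_mem_of_ne_nil t ht
  have key : SameType (⟨c + 1, []⟩ : Word) (⟨c + 1, t⟩ : Word) := by
    refine hC (c + 1) c (by simp) _ (by simp [letters]) (by simp [height, islands, letters]) _ ?_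
    rw [satisfies_iff]
    exact (ListIdentity.refl [c + 1]).append h
  have hmem : [c].Sublist (((c + 1) :: t).destutter (· ≠ ·)) :=
    sublist_destutter (by simp) (by simp [hc])
  have : ((c + 1) :: t).destutter (· ≠ ·) = [c + 1] := key.symm
  rw [this] at hmem
  simp at hmem

lemma PropertyC.destutter_eq (hC : PropertyC 4 M) {S T : List Bool} (h : ListIdentity M S T)
    (h4 : (S.destutter (· ≠ ·)).length ≤ 4) :
    S.destutter (· ≠ ·) = T.destutter (· ≠ ·) := by
  have hinj : Function.Injective Bool.toNat := by decide
  have hm := h.map Bool.toNat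
  cases S with
  | nil => rw [List.map_eq_nil_iff.1 (hC.eq_nil hm)]
  | cons a S =>
    cases T with
    | nil => exact absurd (hC.eq_nil hm.symm) (by simp)
    | cons b T =>
      have key : SameType (⟨a.toNat, S.map Bool.toNat⟩ : Word)
          (⟨b.toNat, T.map Bool.toNat⟩ : Word) := by
        refine hC 0 1 (by simp) _ ?_ ?_ _ ((satisfies_iff _ _).2 hm)
        · intro z hz
          have hz' : z ∈ (a :: S).map Bool.toNat := hz
          obtain ⟨c, -, rfl⟩ := List.mem_map.1 hz'
          cases c <;> simp
        · change (((a :: S).map Bool.toNat).destutter (· ≠ ·)).length ≤ 4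
          rwa [destutter_map hinj, List.length_map]
      have key' : ((a :: S).map Bool.toNat).destutter (· ≠ ·)
        = ((b :: T).map Bool.toNat).destutter (· ≠ ·) := key
      rw [destutter_map hinj, destutter_map hinj] at key'
      exact List.map_injective_iff.2 hinj key'

/-- The form in which Property `(C₄)` is used: if a substitution turns one side of an identity into
a two-letter word without alternating scattered subwords of length five, then the images of both
sides have the same alternating scattered subwords. -/
lemma PropertyC.sublist_iff (hC : PropertyC 4 M) {V : Type*} {s t : List V}
    (h : ListIdentity M s t) (ψ : V → List Bool)
    (h1 : ¬ [true, false, true, false, true].Sublist (s.flatMap ψ))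
    (h2 : ¬ [false, true, false, true, false].Sublist (s.flatMap ψ))
    {p : List Bool} (hp : p.IsChain (· ≠ ·)) :
    p.Sublist (s.flatMap ψ) ↔ p.Sublist (t.flatMap ψ) := by
  have e := hC.destutter_eq (h.flatMap ψ) (length_destutter_le_four h1 h2)
  constructor <;> intro hs
  · exact (e ▸ sublist_destutter hp hs).trans (List.destutter_sublist _ _)
  · exact (e.symm ▸ sublist_destutter hp hs).trans (List.destutter_sublist _ _)

lemma PropertyC.sublist_filterMap_iff (hC : PropertyC 4 M) {s t : List ℕ}
    (h : ListIdentity M s t) (g : ℕ → Option Bool)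
    (h1 : ¬ [true, false, true, false, true].Sublist (s.filterMap g))
    (h2 : ¬ [false, true, false, true, false].Sublist (s.filterMap g))
    {p : List Bool} (hp : p.IsChain (· ≠ ·)) :
    p.Sublist (s.filterMap g) ↔ p.Sublist (t.filterMap g) := by
  simp only [List.filterMap_eq_flatMap_toList] at h1 h2 ⊢
  exact hC.sublist_iff h _ h1 h2 hp

/-- Variables that occur once on one side of an identity occur once on the other side: substitute
`ab` for the variable and erase the others. -/
lemma PropertyC.count_eq_one (hC : PropertyC 4 M) {V : Type*} [DecidableEq V] {s t : List V}
    (h : ListIdentity M s t) {x : V} (hx : s.count x = 1) : t.count x = 1 := by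
  let ψ : V → List Bool := fun v => if v = x then [true, false] else []
  have hψ : ∀ r : List V, r.flatMap ψ = (List.replicate (r.count x) [true, false]).flatten := by
    intro r
    induction r with
    | nil => rfl
    | cons a r ih =>
      by_cases ha : a = x
      · subst ha; simp [ψ, List.replicate_succ] ; simpa [ψ] using ih
      · simp [ψ, ha, List.count_cons_of_ne ha]; simpa [ψ] using ih
  have hs : s.flatMap ψ = [true, false] := by rw [hψ, hx]; rfl
  have key := fun p hp => hC.sublist_iff h ψ (by rw [hs]; decide) (by rw [hs]; decide) (p := p) hp
  rw [hs, hψ t] at key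
  rcases hc : t.count x with _ | _ | c
  · have := (key [true] (by simp)).1 (by decide)
    simp [hc] at this
  · rfl
  · have := (key [true, false, true] (by simp)).2 (by simp [hc, List.replicate_succ])
    exact absurd this (by decide)

/-- If the only occurrence of `x` in `s` is followed by `y` then so is the only occurrence of `x`
in `t`. -/
lemma PropertyC.mem_right (hC : PropertyC 4 M) {V : Type*} [DecidableEq V] {x y : V}
    {s₁ s₂ t₁ t₂ : List V} (h : ListIdentity M (s₁ ++ x :: s₂) (t₁ ++ x :: t₂))
    (hs₁ : x ∉ s₁) (hs₂ : x ∉ s₂) (ht₁ : x ∉ t₁) (hy : y ∈ s₂) : y ∈ t₂ := by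
  have hyx : y ≠ x := fun e => hs₂ (e ▸ hy)
  let ψ : V → List Bool := fun v => if v = x then [true] else if v = y then [false] else []
  have hψ : ∀ r : List V, x ∉ r → true ∉ r.flatMap ψ := by
    intro r hr hmem
    obtain ⟨a, ha, hψa⟩ := List.mem_flatMap.1 hmem
    have : a ≠ x := fun e => hr (e ▸ ha)
    simp only [ψ, if_neg this] at hψa
    split_ifs at hψa <;> simp at hψa
  have hx : ψ x = [true] := by simp [ψ]
  have hfalse : false ∈ s₂.flatMap ψ := List.mem_flatMap.2 ⟨y, hy, by simp [ψ, hyx]⟩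
  have key : [true, false].Sublist ((t₁ ++ x :: t₂).flatMap ψ) := by
    have hno : ∀ p : List Bool, p.count true = 2 ∨ p.count true = 3 →
        ¬ p.Sublist ((s₁ ++ x :: s₂).flatMap ψ) := by
      intro p hp hsub
      have := hsub.count_le true
      simp [hx, List.count_eq_zero_of_not_mem (hψ _ hs₁),
        List.count_eq_zero_of_not_mem (hψ _ hs₂)] at this
      omega
    refine (hC.sublist_iff h ψ (hno _ (by decide)) (hno _ (by decide)) (by simp)).1 ?_
    simp only [List.flatMap_append, List.flatMap_cons, hx]
    refine List.Sublist.trans ?_ (List.sublist_append_right _ _)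
    simpa using hfalse
  simp only [List.flatMap_append, List.flatMap_cons, hx, List.cons_append, List.nil_append] at key
  obtain ⟨r₁, r₂, e, h₁, h₂⟩ := List.cons_sublist_iff.1 key
  rw [List.singleton_sublist] at h₂
  -- the `true` of the pair is the letter substituted for `x`
  have hr : r₂.Sublist (t₂.flatMap ψ) := by
    rcases List.append_eq_append_iff.1 e with ⟨as, rfl, e'⟩ | ⟨bs, e', e''⟩
    · cases as with
      | nil => exact absurd (by simpa only [List.append_nil] using h₁) (hψ _ ht₁)
      | cons a as =>
        simp only [List.cons_append, List.cons.injEq] at e'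
        rw [e'.2]; exact List.sublist_append_right _ _
    · exact absurd (e' ▸ List.mem_append_left _ h₁) (hψ _ ht₁)
  obtain ⟨a, ha, hψa⟩ := List.mem_flatMap.1 (hr.subset h₂)
  have hay : a = y := by
    by_contra hne
    simp only [ψ, if_neg hne] at hψa
    split_ifs at hψa <;> simp at hψa
  exact hay ▸ ha

end PropertyC

/-! ### Words forming an identity with `U_n` -/

lemma letters_ascending (k : ℕ) : letters (ascending k) = List.range (k + 1) := by
  induction k with
  | zero => rfl
  | succ k ih => rw [ascending, letters_mul, ih, var, letters_of, ← List.range_succ]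

lemma letters_descending (k : ℕ) : letters (descending k) = (List.range (k + 1)).reverse := by
  induction k with
  | zero => rfl
  | succ k ih => rw [descending, letters_mul, ih, var, letters_of, List.range_succ (n := k + 1)]; simp

lemma letters_wordU (k : ℕ) : letters (wordU k) =
    List.range (k + 1) ++ ((List.range (k + 1)).reverse ++ List.range (k + 1)) := by
  rw [wordU, letters_mul, letters_mul, letters_ascending, letters_descending, List.append_assoc]

lemma pairwise_letters_squares (k : ℕ) :
    (letters (squares k)).Pairwise (· ≤ ·) ∧ ∀ i ∈ letters (squares k), i ≤ k := by
  induction k with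
  | zero => simp [squares, letters_mul, var, letters_of]
  | succ k ih =>
    simp only [squares, letters_mul, var, letters_of, List.pairwise_append, List.mem_append]
    refine ⟨⟨ih.1, by simp, ?_⟩, ?_⟩
    · intro a ha b hb
      have := ih.2 a ha
      simp at hb; omega
    · rintro i (hi | hi)
      · exact (ih.2 i hi).trans (Nat.le_succ k)
      · simp at hi; omega

/-- If no `false` precedes a `true` in `R`, then `R`, its reverse and `R` again form at most four
islands. -/
lemma not_sublist_append_reverse {R : List Bool} (hR : ¬ [false, true].Sublist R) :
    ¬ [false, true, false, true].Sublist (R ++ (R.reverse ++ R)) := by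
  have hR' : ¬ [true, false].Sublist R.reverse := fun h => hR (by simpa using h.reverse)
  intro h
  obtain ⟨p, q, e, hp, hq⟩ := List.sublist_append_iff.1 h
  obtain ⟨q, r, rfl, hq, hr⟩ := List.sublist_append_iff.1 hq
  have hp2 : p.length ≤ 1 := by
    by_contra! hlt
    refine hR (List.Sublist.trans ?_ hp)
    match p, hlt with
    | a :: b :: p, _ => simp at e; simp [← e.1, ← e.2.1]
  have hr2 : r.length ≤ 1 := by
    by_contra! hlt
    refine hR (List.Sublist.trans ?_ hr)
    have hsuf : [false, true] <:+ [false, true, false, true] := by decide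
    have : r <:+ [false, true, false, true] := ⟨p ++ q, by rw [e, List.append_assoc]⟩
    exact (List.suffix_of_suffix_length_le hsuf this hlt).sublist
  refine hR' (List.Sublist.trans ?_ hq)
  rcases p with _ | ⟨a, _ | ⟨b, p⟩⟩ <;> rcases r with _ | ⟨c, _ | ⟨d, r⟩⟩ <;>
    rcases q with _ | ⟨x, _ | ⟨y, _ | ⟨z, _ | ⟨w, q⟩⟩⟩⟩ <;> simp at e hp2 hr2 <;> simp_all

/-- A substitution of single letters or the empty word into `U_n` that sends smaller variables to
`true` and larger ones to `false` produces at most four islands. -/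
lemma not_sublist_filterMap_wordU (k : ℕ) {g : ℕ → Option Bool}
    (hg : ∀ i j, g i = some false → g j = some true → j < i) :
    ¬ [false, true, false, true].Sublist ((letters (wordU k)).filterMap g) := by
  rw [letters_wordU, List.filterMap_append, List.filterMap_append, List.filterMap_reverse]
  apply not_sublist_append_reverse
  intro h
  have : ((List.range (k + 1)).filterMap g).Pairwise fun a b => ¬ (a = false ∧ b = true) := by
    rw [List.pairwise_filterMap]
    refine List.pairwise_lt_range.imp ?_
    rintro a b hab x hx y hy ⟨rfl, rfl⟩
    exact absurd (hg a b hx hy) (by omega)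
  simpa using this.sublist h

/-- Erases all letters but `x` and `y`, which become `true` and `false`. -/
def select (x y : ℕ) (j : ℕ) : Option Bool :=
  if j = x then some true else if j = y then some false else none

lemma select_left (x y : ℕ) : select x y x = some true := by simp [select]

lemma select_right {x y : ℕ} (h : x ≠ y) : select x y y = some false := by
  simp [select, h.symm]

lemma select_eq_some {x y j : ℕ} {b : Bool} (h : select x y j = some b) :
    (bif b then x else y) = j := by
  unfold select at h
  split_ifs at h with h1 h2 <;> simp at h <;> subst h <;> simp [*]

lemma map_filterMap_select_sublist (x y : ℕ) (w : List ℕ) :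
    ((w.filterMap (select x y)).map fun b => bif b then x else y).Sublist w := by
  induction w with
  | nil => simp
  | cons a w ih =>
    cases h : select x y a with
    | none => rw [List.filterMap_cons_none h]; exact ih.cons a
    | some b =>
      rw [List.filterMap_cons_some h, List.map_cons, select_eq_some h]; exact ih.cons_cons a

/-- A scattered subword of the two-letter image of `w` comes from a scattered subword of `w`. -/
lemma sublist_of_select {x y : ℕ} {p : List Bool} {w : List ℕ}
    (h : p.Sublist (w.filterMap (select x y))) :
    (p.map fun b => bif b then x else y).Sublist w :=
  (h.map _).trans (map_filterMap_select_sublist x y w)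

/-- The restrictions that Property `(C₄)` imposes on a word `w` forming an identity with `U_n`,
`n = k + 1`: for variables `x < y` the islands of `x` and `y` in `w` are `x, y, x, y`, and this
remains true if two smaller variables, or two larger ones, are identified. -/
structure IsTyped (k : ℕ) (w : List ℕ) : Prop where
  /-- No descent `y x` is followed by another one, even up to identifications. -/
  not_sublist {x x' y y' : ℕ} : x < y → x < y' → x' < y → x' < y' → ¬ [y, x, y', x'].Sublist w
  /-- Two variables alternate as in `U_n`. -/
  sublist {x y : ℕ} : x < y → y ≤ k → [x, y, x, y].Sublist w

lemma PropertyC.isTyped {M : Type*} [Monoid M] (hC : PropertyC 4 M) {k : ℕ} {w : List ℕ}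
    (h : ListIdentity M (letters (wordU k)) w) : IsTyped k w := by
  have key : ∀ g : ℕ → Option Bool, (∀ i j, g i = some false → g j = some true → j < i) →
      ∀ p : List Bool, p.IsChain (· ≠ ·) →
        (p.Sublist ((letters (wordU k)).filterMap g) ↔ p.Sublist (w.filterMap g)) := by
    intro g hg p hp
    have hno := not_sublist_filterMap_wordU k hg
    exact hC.sublist_filterMap_iff h g (fun h' => hno (.trans (by decide) h'))
      (fun h' => hno (.trans (by decide) h')) hp
  constructor
  · intro x x' y y' h1 h2 h3 h4 hs
    let g : ℕ → Option Bool := fun j =>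
      if j = x ∨ j = x' then some true else if j = y ∨ j = y' then some false else none
    have hg : ∀ i j, g i = some false → g j = some true → j < i := by
      intro i j hi hj
      grind
    refine not_sublist_filterMap_wordU k hg ((key g hg _ (by simp)).2 ?_)
    have := hs.filterMap g
    have e : [y, x, y', x'].filterMap g = [false, true, false, true] := by
      have : y ≠ x ∧ y ≠ x' ∧ y' ≠ x ∧ y' ≠ x' := by omega
      simp [g, this]
    rwa [e] at this
  · intro x y hxy hy
    have hg : ∀ i j, select x y i = some false → select x y j = some true → j < i := by
      intro i j hi hj
      have hi := select_eq_some hi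
      have hj := select_eq_some hj
      simp at hi hj; omega
    have hU : [x, y, x, y].Sublist (letters (wordU k)) := by
      have hx : x ∈ List.range (k + 1) := by simp; omega
      have hy : y ∈ List.range (k + 1) := by simp; omega
      have h2 : [x, y].Sublist (List.range (k + 1)) := by
        have e : [x, y] = (List.range (y + 1)).filter fun j => j = x ∨ j = y := by
          apply List.Perm.eq_of_pairwise' (r := (· < ·))
          · simpa using hxy
          · exact List.pairwise_lt_range.filter _
          · rw [List.perm_ext_iff_of_nodup (by simp; omega) (List.nodup_range.filter _)]
            intro j; simp; omega
        rw [e]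
        exact List.filter_sublist.trans (List.range_sublist.2 (by omega))
      rw [letters_wordU]
      exact h2.append (h2.trans (List.sublist_append_right _ _))
    have h4 := hU.filterMap (select x y)
    have e : [x, y, x, y].filterMap (select x y) = [true, false, true, false] := by
      simp [select_left, select_right hxy.ne]
    rw [e] at h4
    simpa using sublist_of_select ((key _ hg _ (by simp)).1 h4)

section Sublists

variable {α : Type*} {a : α} {A B p : List α}

lemma cons_sublist_append (ha : a ∈ A) (hp : p.Sublist B) : (a :: p).Sublist (A ++ B) :=
  List.cons_sublist_iff.2 ⟨A, B, rfl, ha, hp⟩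

lemma sublist_append_of_right (hp : p.Sublist B) : p.Sublist (A ++ B) :=
  hp.trans (List.sublist_append_right A B)

/-- Scattered subwords that start with a letter missing in a prefix. -/
lemma cons_sublist_of_notMem (ha : a ∉ A) (h : (a :: p).Sublist (A ++ B)) :
    (a :: p).Sublist B := by
  induction A with
  | nil => exact h
  | cons b A ih =>
    simp only [List.mem_cons, not_or] at ha
    rcases List.sublist_cons_iff.1 h with h | ⟨r, e, -⟩
    · exact ih ha.2 h
    · simp at e; exact absurd e.1 ha.1

/-- Scattered subwords that end with a letter missing in a suffix. -/
lemma concat_sublist_of_notMem (ha : a ∉ B) (h : (p ++ [a]).Sublist (A ++ B)) :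
    (p ++ [a]).Sublist A := by
  have h' := h.reverse
  simp only [List.reverse_append, List.reverse_singleton, List.singleton_append] at h'
  simpa using (cons_sublist_of_notMem (by simpa using ha) h').reverse

end Sublists

namespace IsTyped

variable {k : ℕ} {w : List ℕ}

lemma mem_left (hw : IsTyped k w) {x y : ℕ} {u v : List ℕ} (e : w = u ++ y :: v) (hxy : x < y)
    (hy : y ≤ k) : x ∈ u := by
  subst e
  by_contra hx
  rcases List.sublist_cons_iff.1 (cons_sublist_of_notMem hx (hw.sublist hxy hy)) with h | ⟨r, e, -⟩
  · refine hw.not_sublist hxy hxy hxy hxy (sublist_append_of_right (List.Sublist.cons_cons y ?_))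
    exact (List.sublist_append_left [x, y, x] [y]).trans h
  · simp at e; omega

lemma mem_right (hw : IsTyped k w) {x y : ℕ} {u v : List ℕ} (e : w = u ++ x :: v) (hxy : x < y)
    (hy : y ≤ k) : y ∈ v := by
  subst e
  by_contra hv
  have h := concat_sublist_of_notMem (p := [x, y, x]) (a := y) (by simp [hv, hxy.ne'])
    (hw.sublist hxy hy)
  refine hw.not_sublist hxy hxy hxy hxy
    (List.Sublist.append (l₁ := [y, x, y]) (r₁ := [x]) ?_ (by simp))
  exact (List.sublist_append_right [x] [y, x, y]).trans h

/-- After an occurrence of `k` and before an occurrence of `0`, the variables occur in descending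
order: `l < l'` with `l` to the left of `l'` would give a descent `k l` followed by `l' l`. -/
lemma not_ascending (hw : IsTyped k w) {l l' : ℕ} (hl : 0 < l) (hll : l < l') (hk : l' ≤ k)
    {A B C : List ℕ} (e : w = A ++ l :: (B ++ l' :: C)) (hA : k ∈ A) (hC : 0 ∈ C) : False := by
  obtain ⟨C₁, C₂, rfl⟩ := List.append_of_mem hC
  have h2 : l ∈ C₂ := hw.mem_right (u := A ++ l :: (B ++ l' :: C₁)) (x := 0)
    (by simp [e]) hl (by omega)
  refine hw.not_sublist (x := l) (x' := l) (y := k) (y' := l') (by omega) hll (by omega) hll ?_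
  rw [e]
  refine cons_sublist_append hA (List.Sublist.cons_cons l (sublist_append_of_right
    (List.Sublist.cons_cons l' (sublist_append_of_right (List.Sublist.cons _ ?_)))))
  simpa using h2

end IsTyped

/-! ### Variables that cover two letters of the descending part -/

section Substitution

variable {V : Type*} {θ : V → List ℕ} {s : List V} {k : ℕ}

lemma exists_split_flatMap (θ : V → List ℕ) (s : List V) {l : ℕ} : ∀ {A B : List ℕ},
    s.flatMap θ = A ++ l :: B → ∃ s₁ h s₂ α β, s = s₁ ++ h :: s₂ ∧ θ h = α ++ l :: β ∧
      A = s₁.flatMap θ ++ α ∧ B = β ++ s₂.flatMap θ := by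
  induction s with
  | nil => intro A B h; simp at h
  | cons a s ih =>
    intro A B h
    rw [List.flatMap_cons] at h
    rcases List.append_eq_append_iff.1 h with ⟨as, rfl, e⟩ | ⟨bs, e, e'⟩
    · obtain ⟨s₁, v, s₂, α, β, rfl, hh, rfl, rfl⟩ := ih e
      exact ⟨a :: s₁, v, s₂, α, β, rfl, hh, by simp, rfl⟩
    · cases bs with
      | nil =>
        obtain ⟨s₁, v, s₂, α, β, rfl, hh, hA, rfl⟩ := ih (A := []) (by simpa using e'.symm)
        refine ⟨a :: s₁, v, s₂, α, β, rfl, hh, ?_, rfl⟩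
        rw [List.flatMap_cons, List.append_assoc, ← hA]
        simpa using e.symm
      | cons b bs =>
        simp only [List.cons_append, List.cons.injEq] at e'
        obtain ⟨rfl, rfl⟩ := e'
        exact ⟨[], a, s, A, bs, rfl, e, by simp, rfl⟩

lemma sublist_flatMap_of_mem {h : V} {p : List ℕ} (hp : p.Sublist (θ h)) (hs : h ∈ s) :
    p.Sublist (s.flatMap θ) := by
  obtain ⟨s₁, s₂, rfl⟩ := List.append_of_mem hs
  rw [List.flatMap_append, List.flatMap_cons]
  exact sublist_append_of_right (hp.trans (List.sublist_append_left _ _))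

lemma append_self_sublist_flatMap {h : V} {p : List ℕ} {s₁ s₂ : List V} (hp : p.Sublist (θ h))
    (hs : h ∈ s₁ ∨ h ∈ s₂) : (p ++ p).Sublist ((s₁ ++ h :: s₂).flatMap θ) := by
  rw [List.flatMap_append, List.flatMap_cons]
  rcases hs with hs | hs
  · exact (sublist_flatMap_of_mem hp hs).append (hp.trans (List.sublist_append_left _ _))
  · exact sublist_append_of_right (hp.append (sublist_flatMap_of_mem hp hs))

/-- `Covers θ k s h l` : some occurrence of the variable `h` in `s` covers, under the substitution
`θ`, an occurrence of `l` that has a `k` to its left and a `0` to its right; the prefix of `θ h`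
before this occurrence is `α`, the suffix after it is `β`. -/
structure Covers (θ : V → List ℕ) (k : ℕ) (s : List V) (h : V) (l : ℕ) (s₁ s₂ : List V)
    (α β : List ℕ) : Prop where
  eq_append : s = s₁ ++ h :: s₂
  image_eq : θ h = α ++ l :: β
  mem_left : k ∈ s₁.flatMap θ ++ α
  mem_right : 0 ∈ β ++ s₂.flatMap θ

lemma Covers.flatMap_eq {h : V} {l : ℕ} {s₁ s₂ : List V} {α β : List ℕ}
    (c : Covers θ k s h l s₁ s₂ α β) :
    s.flatMap θ = (s₁.flatMap θ ++ α) ++ l :: (β ++ s₂.flatMap θ) := by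
  rw [c.eq_append, List.flatMap_append, List.flatMap_cons, c.image_eq]; simp

lemma exists_covers {l : ℕ} (h : [k, l, 0].Sublist (s.flatMap θ)) :
    ∃ h s₁ s₂ α β, Covers θ k s h l s₁ s₂ α β := by
  obtain ⟨A, C, e, hk, h⟩ := List.cons_sublist_iff.1 h
  obtain ⟨B, D, rfl, hl, h0⟩ := List.cons_sublist_iff.1 h
  obtain ⟨B₁, B₂, rfl⟩ := List.append_of_mem hl
  obtain ⟨s₁, v, s₂, α, β, hs, hv, hA, hB⟩ :=
    exists_split_flatMap (l := l) (A := A ++ B₁) (B := B₂ ++ D) θ s (by simp [e])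
  refine ⟨v, s₁, s₂, α, β, hs, hv, ?_, ?_⟩
  · rw [← hA]; simp [hk]
  · rw [← hB]; simp [List.singleton_sublist.1 h0]

/-- A variable that covers two different letters between an occurrence of `k` and an occurrence of
`0` is linear, and the two letters appear in its image in descending order. -/
lemma IsTyped.linear_of_covers (hw : IsTyped k (s.flatMap θ)) {l l' : ℕ} (hl : 0 < l)
    (hll : l < l') (hk : l' < k) {h : V} {s₁ s₂ s₁' s₂' : List V} {α β α' β' : List ℕ}
    (c : Covers θ k s h l s₁ s₂ α β) (c' : Covers θ k s h l' s₁' s₂' α' β') :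
    h ∉ s₁ ∧ h ∉ s₂ ∧ l' ∈ α := by
  have hdesc : [l', l].Sublist (θ h) → ¬ (h ∈ s₁ ∨ h ∈ s₂) := by
    intro hsub hmem
    refine hw.not_sublist hll hll hll hll ?_
    have := append_self_sublist_flatMap hsub hmem
    rwa [← c.eq_append] at this
  -- the case that both letters are covered by the same occurrence of `h`
  have hsame : s₁ = s₁' → s₂ = s₂' → h ∉ s₁ ∧ h ∉ s₂ ∧ l' ∈ α := by
    rintro rfl rfl
    have e' : α ++ l :: β = α' ++ l' :: β' := by rw [← c.image_eq, ← c'.image_eq]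
    rcases List.append_eq_append_iff.1 e' with ⟨m, f₁, f₂⟩ | ⟨m, f₁, f₂⟩
    · cases m with
      | nil => simp at f₂; omega
      | cons b m =>
        simp only [List.cons_append, List.cons.injEq] at f₂
        obtain ⟨rfl, rfl⟩ := f₂
        refine (hw.not_ascending hl hll hk.le (A := s₁.flatMap θ ++ α) (B := m)
          (C := β' ++ s₂.flatMap θ) ?_ c.mem_left c'.mem_right).elim
        rw [c.flatMap_eq]; simp
    · cases m with
      | nil => simp at f₂; omega
      | cons b m =>
        simp only [List.cons_append, List.cons.injEq] at f₂
        obtain ⟨rfl, rfl⟩ := f₂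
        have hmem : l' ∈ α := by simp [f₁]
        have := hdesc (by rw [c.image_eq]; exact cons_sublist_append hmem (by simp))
        exact ⟨fun h => this (.inl h), fun h => this (.inr h), hmem⟩
  have e : s₁ ++ h :: s₂ = s₁' ++ h :: s₂' := by rw [← c.eq_append, ← c'.eq_append]
  rcases List.append_eq_append_iff.1 e with ⟨as, e₁, e₂⟩ | ⟨bs, e₁, e₂⟩
  · cases as with
    | nil =>
      simp only [List.append_nil, List.nil_append, List.cons.injEq, true_and] at e₁ e₂
      exact hsame e₁.symm e₂
    | cons a m =>
      -- the occurrence covering `l` is to the left of the one covering `l'`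
      simp only [List.cons_append, List.cons.injEq] at e₂
      obtain ⟨rfl, rfl⟩ := e₂
      refine (hw.not_ascending hl hll hk.le (A := s₁.flatMap θ ++ α)
        (B := β ++ m.flatMap θ ++ α') (C := β' ++ s₂'.flatMap θ) ?_ c.mem_left c'.mem_right).elim
      rw [c.flatMap_eq, List.flatMap_append, List.flatMap_cons, c'.image_eq]; simp
  · cases bs with
    | nil =>
      simp only [List.append_nil, List.nil_append, List.cons.injEq, true_and] at e₁ e₂
      exact hsame e₁ e₂.symm
    | cons a m =>
      -- the occurrence covering `l'` is to the left of the one covering `l`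
      exfalso
      simp only [List.cons_append, List.cons.injEq] at e₂
      obtain ⟨rfl, rfl⟩ := e₂
      have hno : ¬ [l', l].Sublist (θ h) := fun hsub => hdesc hsub (.inl (by simp [e₁]))
      have hlα : l ∈ α' := by
        have : l ∈ θ h := by rw [c.image_eq]; simp
        rw [c'.image_eq, List.mem_append, List.mem_cons] at this
        rcases this with h | h | h
        · exact h
        · omega
        · exact (hno (by rw [c'.image_eq]; exact sublist_append_of_right (by simpa using h))).elim
      obtain ⟨γ, δ, rfl⟩ := List.append_of_mem hlα
      have hk' : k ∈ s₁'.flatMap θ ++ γ ∨ k ∈ δ := by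
        have := c'.mem_left
        simp only [List.mem_append, List.mem_cons] at this ⊢
        have : k ≠ l := by omega
        tauto
      rcases hk' with hk' | hk'
      · -- `k l` is followed by `l' l`
        refine hw.not_sublist (x := l) (x' := l) (y := k) (y' := l') (by omega) hll (by omega)
          hll ?_
        rw [c.flatMap_eq, e₁]
        have e3 : (s₁' ++ h :: m).flatMap θ ++ α ++ l :: (β ++ s₂.flatMap θ) =
            (s₁'.flatMap θ ++ γ) ++ (l :: (δ ++ l' :: ((β' ++ m.flatMap θ ++ α) ++
              l :: (β ++ s₂.flatMap θ)))) := by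
          rw [List.flatMap_append, List.flatMap_cons, c'.image_eq]; simp
        rw [e3]
        exact cons_sublist_append hk' (List.Sublist.cons_cons l (sublist_append_of_right
          (List.Sublist.cons_cons l' (sublist_append_of_right (by simp)))))
      · -- `k l'` occurs twice
        have hsub : [k, l'].Sublist (θ h) := by
          rw [c'.image_eq]
          have : (γ ++ l :: δ) ++ l' :: β' = (γ ++ [l] ++ δ) ++ l' :: β' := by simp
          rw [this]
          exact cons_sublist_append (by simp [hk']) (by simp)
        refine hw.not_sublist hk hk hk hk ?_
        have := append_self_sublist_flatMap (s₁ := s₁) (s₂ := s₂) hsub (.inl (by simp [e₁]))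
        rwa [← c.eq_append] at this

end Substitution

/-! ### Preservation of the descending part under identities with few variables -/

lemma sublist_or_sublist_of_append {α : Type*} {a b x z : List α} {c : α}
    (h : (a ++ c :: b).Sublist (x ++ z)) : (a ++ [c]).Sublist x ∨ (c :: b).Sublist z := by
  obtain ⟨p, q, e, hp, hq⟩ := List.sublist_append_iff.1 h
  rcases List.append_eq_append_iff.1 e with ⟨m, rfl, e'⟩ | ⟨m, rfl, rfl⟩
  · cases m with
    | nil => right; rw [e']; exact hq
    | cons d m =>
      simp only [List.cons_append, List.cons.injEq] at e'
      left; rw [e'.1]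
      exact (List.Sublist.append_left (by simp) a).trans hp
  · right; exact sublist_append_of_right (A := m) (List.Sublist.refl _) |>.trans hq

lemma sublist_of_sublist_true_cons {p y : List Bool} (h : (false :: p).Sublist (true :: y)) :
    (false :: p).Sublist y := by
  rcases List.sublist_cons_iff.1 h with h | ⟨r, e, -⟩
  · exact h
  · simp at e

lemma not_alternating_five_left {x y : List Bool} (hx : ¬ [false, true, false].Sublist x)
    (hy : ¬ [false, true].Sublist y) :
    ¬ [true, false, true, false, true].Sublist (x ++ true :: y) ∧
      ¬ [false, true, false, true, false].Sublist (x ++ true :: y) := by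
  constructor <;> intro h
  · rcases sublist_or_sublist_of_append (a := [true, false, true]) (b := [true]) h with h | h
    · exact hx (.trans (by decide) h)
    · exact hy (sublist_of_sublist_true_cons h)
  · rcases sublist_or_sublist_of_append (a := [false, true]) (b := [true, false]) h with h | h
    · exact hx h
    · exact hy (.trans (by decide) (sublist_of_sublist_true_cons h))

lemma not_alternating_five_right {x y : List Bool} (hx : ¬ [true, false].Sublist x)
    (hy : ¬ [false, true, false].Sublist y) :
    ¬ [true, false, true, false, true].Sublist (x ++ true :: y) ∧
      ¬ [false, true, false, true, false].Sublist (x ++ true :: y) := by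
  constructor <;> intro h
  · rcases sublist_or_sublist_of_append (a := [true]) (b := [true, false, true]) h with h | h
    · exact hx h
    · exact hy (.trans (by decide) (sublist_of_sublist_true_cons h))
  · rcases sublist_or_sublist_of_append (a := [false, true]) (b := [true, false]) h with h | h
    · exact hx (.trans (by decide) h)
    · exact hy (sublist_of_sublist_true_cons h)

section Step

variable {M : Type*} [Monoid M] {V : Type*} [DecidableEq V] {k : ℕ}

/-- For a linear variable `h` with `θ h = α l β`, replace this occurrence of `l` by the letter
`true` and apply `g` to all other letters of the images under `θ`. -/
def markedSubst (θ : V → List ℕ) (g : ℕ → Option Bool) (h : V) (α β : List ℕ) (v : V) :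
    List Bool :=
  if v = h then α.filterMap g ++ true :: β.filterMap g else (θ v).filterMap g

lemma flatMap_markedSubst (θ : V → List ℕ) (g : ℕ → Option Bool) {h : V} (α β : List ℕ)
    {s₁ s₂ : List V} (h₁ : h ∉ s₁) (h₂ : h ∉ s₂) :
    (s₁ ++ h :: s₂).flatMap (markedSubst θ g h α β) =
      (s₁.flatMap θ ++ α).filterMap g ++ true :: (β ++ s₂.flatMap θ).filterMap g := by
  have key : ∀ r : List V, h ∉ r →
      r.flatMap (markedSubst θ g h α β) = (r.flatMap θ).filterMap g := by
    intro r hr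
    rw [List.filterMap_flatMap]
    refine List.flatMap_congr fun v hv => ?_
    have : v ≠ h := fun e => hr (e ▸ hv)
    simp [markedSubst, this]
  rw [List.flatMap_append, List.flatMap_cons, key _ h₁, key _ h₂]
  simp [markedSubst]

/-- The heart of the argument. A linear variable `h` covers a marked occurrence of `l`, to the right
of a larger letter `l'`, between `k` and `0`. If `k`, `i`, `0` occur in this order in the image of
one side of an identity, they do so in the image of the other side: otherwise, after identifying
the marked letter with `0` if `i < l` and with `k` if `l < i`, the image of the left-hand side has
the alternating subword `i, l, i, l, i`, while the image of the right-hand side has height four. -/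
lemma PropertyC.sublist_of_linear (hC : PropertyC 4 M) {θ : V → List ℕ} {h : V}
    {s₁ s₂ t₁ t₂ : List V} {α β : List ℕ} {l l' i : ℕ}
    (hst : ListIdentity M (s₁ ++ h :: s₂) (t₁ ++ h :: t₂))
    (hs : IsTyped k ((s₁ ++ h :: s₂).flatMap θ)) (ht : IsTyped k ((t₁ ++ h :: t₂).flatMap θ))
    (hs₁ : h ∉ s₁) (hs₂ : h ∉ s₂) (ht₁ : h ∉ t₁) (ht₂ : h ∉ t₂)
    (hl : 0 < l) (hll : l < l') (hk : l' < k) (hi : 0 < i) (hik : i < k) (hil : i ≠ l)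
    (c : Covers θ k (s₁ ++ h :: s₂) h l s₁ s₂ α β) (hα : l' ∈ α)
    (hP : [k, i, 0].Sublist ((s₁ ++ h :: s₂).flatMap θ)) :
    [k, i, 0].Sublist ((t₁ ++ h :: t₂).flatMap θ) := by
  by_contra hQ
  have hws := c.flatMap_eq
  have hwt : (t₁ ++ h :: t₂).flatMap θ = (t₁.flatMap θ ++ α) ++ l :: (β ++ t₂.flatMap θ) := by
    rw [List.flatMap_append, List.flatMap_cons, c.image_eq]; simp
  have hk_s := c.mem_left
  have h0_s := c.mem_right
  have hright : i ∈ β ++ s₂.flatMap θ → i ∈ β ++ t₂.flatMap θ := by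
    intro hmem
    rcases List.mem_append.1 hmem with hmem | hmem
    · exact List.mem_append_left _ hmem
    · obtain ⟨x, hx, hix⟩ := List.mem_flatMap.1 hmem
      exact List.mem_append_right _
        (List.mem_flatMap.2 ⟨x, hC.mem_right hst hs₁ hs₂ ht₁ hx, hix⟩)
  have hα_t : l' ∈ t₁.flatMap θ ++ α := List.mem_append_right _ hα
  have mark := fun (g : ℕ → Option Bool)
      (h1 : [false, true, false, true, false].Sublist
        ((s₁.flatMap θ ++ α).filterMap g ++ true :: (β ++ s₂.flatMap θ).filterMap g))
      (h2 : ¬ [true, false, true, false, true].Sublist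
          ((t₁.flatMap θ ++ α).filterMap g ++ true :: (β ++ t₂.flatMap θ).filterMap g) ∧
        ¬ [false, true, false, true, false].Sublist
          ((t₁.flatMap θ ++ α).filterMap g ++ true :: (β ++ t₂.flatMap θ).filterMap g)) => by
    rw [← flatMap_markedSubst θ g α β hs₁ hs₂] at h1
    rw [← flatMap_markedSubst θ g α β ht₁ ht₂] at h2
    exact h2.2 ((hC.sublist_iff hst.symm _ h2.1 h2.2 (by simp)).2 h1)
  generalize s₁.flatMap θ ++ α = u at *
  generalize β ++ s₂.flatMap θ = v at *
  generalize t₁.flatMap θ ++ α = u' at *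
  generalize β ++ t₂.flatMap θ = v' at *
  rw [hws] at hs hP
  rw [hwt] at ht hQ
  -- the marked letter is also to the right of some `k` in the image of the right-hand side
  have hk_t : k ∈ u' := by
    by_contra hku
    have h4 := ht.sublist (x := l) (y := k) (by omega) le_rfl
    have h3 : [k, l].Sublist v' := by
      have h5 := cons_sublist_of_notMem (p := [l, k]) hku ((List.sublist_cons_self l _).trans h4)
      rcases List.sublist_cons_iff.1 h5 with h5 | ⟨r, e, -⟩
      · exact (List.sublist_append_left [k, l] [k]).trans h5
      · simp at e; omega
    exact ht.not_sublist (x := l) (x' := l) (y := l') (y' := k) hll (by omega) hll (by omega)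
      (cons_sublist_append hα_t (List.Sublist.cons_cons l h3))
  -- the position of the marked letter relative to the occurrence of `i` between `k` and `0`
  obtain ⟨A, D, eAD, hkA, hD⟩ := List.cons_sublist_iff.1 hP
  obtain ⟨B, C, rfl, hiB, h0C⟩ := List.cons_sublist_iff.1 hD
  rw [List.singleton_sublist] at h0C
  obtain ⟨B₁, B₂, rfl⟩ := List.append_of_mem hiB
  have e : u ++ l :: v = (A ++ B₁) ++ i :: (B₂ ++ C) := by rw [eAD]; simp
  have hkA' : k ∈ A ++ B₁ := List.mem_append_left _ hkA
  have h0C' : 0 ∈ B₂ ++ C := List.mem_append_right _ h0C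
  generalize A ++ B₁ = X at *
  generalize B₂ ++ C = Y at *
  rcases lt_or_gt_of_ne hil with hlt | hlt
  · -- `i < l`
    have hiu : i ∈ u := hs.mem_left rfl hlt (by omega)
    have hv : [i, 0, i].Sublist v := by
      rcases List.append_eq_append_iff.1 e with ⟨m, rfl, e'⟩ | ⟨m, rfl, e'⟩
      · cases m with
        | nil => simp at e'; omega
        | cons b m =>
          simp only [List.cons_append, List.cons.injEq] at e'
          obtain ⟨rfl, rfl⟩ := e'
          obtain ⟨Y₁, Y₂, rfl⟩ := List.append_of_mem h0C'
          have : i ∈ Y₂ := hs.mem_right (x := 0) (u := u ++ l :: (m ++ i :: Y₁)) (by simp) hi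
            hik.le
          exact sublist_append_of_right (List.Sublist.cons_cons i (sublist_append_of_right
            (by simpa using this)))
      · cases m with
        | nil => simp at e'; omega
        | cons b m =>
          simp only [List.cons_append, List.cons.injEq] at e'
          obtain ⟨rfl, rfl⟩ := e'
          exact (hs.not_ascending hi hlt (by omega) (A := X) (B := m) (C := v) (by simp) hkA'
            h0_s).elim
    have hiv : i ∈ v' := hright (hv.subset (by simp))
    have h0i : (0 : ℕ) ≠ i := hi.ne
    refine mark (select 0 i) ?_ (not_alternating_five_left ?_ ?_)
    · have h1 : [false].Sublist (u.filterMap (select 0 i)) := by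
        simpa [select_right h0i] using (List.singleton_sublist.2 hiu).filterMap (select 0 i)
      have h2 : [false, true, false].Sublist (v.filterMap (select 0 i)) := by
        simpa [select_right h0i, select_left] using hv.filterMap (select 0 i)
      exact h1.append (h2.cons_cons true)
    · intro hsub
      have hsub : [i, 0, i].Sublist u' := by simpa using sublist_of_select hsub
      obtain ⟨X₁, X₂, rfl, hX₁, hX₂⟩ :=
        (List.append_sublist_iff (l₁ := [i, 0]) (l₂ := [i])).1 hsub
      rw [List.singleton_sublist] at hX₂
      obtain ⟨Z₁, Z₂, rfl⟩ := List.append_of_mem hX₂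
      -- no `k` precedes the last letter of this subword, so `k`, `0`, `k` follow it
      have hkZ : k ∉ X₁ ++ (Z₁ ++ [i]) := by
        intro hmem
        have hmem : k ∈ X₁ ++ Z₁ := by
          simp only [List.mem_append, List.mem_singleton] at hmem ⊢
          have : k ≠ i := by omega
          tauto
        refine ht.not_sublist (x := i) (x' := i) (y := k) (y' := l) hik hlt hik hlt ?_
        have : X₁ ++ (Z₁ ++ i :: Z₂) ++ l :: v' = (X₁ ++ Z₁) ++ i :: (Z₂ ++ l :: v') := by simp
        rw [this]
        exact cons_sublist_append hmem (List.Sublist.cons_cons i (sublist_append_of_right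
          (List.Sublist.cons_cons l (by simpa using hiv))))
      have h4 := ht.sublist (x := 0) (y := k) (by omega) le_rfl
      have e2 : X₁ ++ (Z₁ ++ i :: Z₂) ++ l :: v' = (X₁ ++ (Z₁ ++ [i])) ++ (Z₂ ++ l :: v') := by
        simp
      rw [e2] at h4
      have h5 := cons_sublist_of_notMem (p := [0, k]) hkZ ((List.sublist_cons_self 0 _).trans h4)
      refine ht.not_sublist (x := 0) (x' := 0) (y := i) (y' := i) hi hi hi hi ?_
      rw [e2]
      have h6 : [i, 0, i].Sublist (X₁ ++ (Z₁ ++ [i])) :=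
        List.Sublist.append hX₁ (sublist_append_of_right (by simp))
      have h7 : [0].Sublist (Z₂ ++ l :: v') := .trans (by simp) h5
      exact h6.append h7
    · intro hsub
      have hsub : [i, 0].Sublist v' := by simpa using sublist_of_select hsub
      exact hQ (cons_sublist_append hk_t (hsub.cons l))
  · -- `l < i`
    have hik' : k ≠ i := by omega
    have hiv : i ∈ v := hs.mem_right rfl hlt hik.le
    have hu : [i, k, i].Sublist u := by
      rcases List.append_eq_append_iff.1 e with ⟨m, rfl, e'⟩ | ⟨m, rfl, e'⟩
      · cases m with
        | nil => simp at e'; omega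
        | cons b m =>
          simp only [List.cons_append, List.cons.injEq] at e'
          obtain ⟨rfl, rfl⟩ := e'
          exact (hs.not_ascending hl hlt hik.le (A := u) (B := m) (C := Y) (by simp) hk_s
            h0C').elim
      · cases m with
        | nil => simp at e'; omega
        | cons b m =>
          simp only [List.cons_append, List.cons.injEq] at e'
          obtain ⟨rfl, rfl⟩ := e'
          obtain ⟨X₁, X₂, rfl⟩ := List.append_of_mem hkA'
          have : i ∈ X₁ := hs.mem_left (y := k) (v := X₂ ++ i :: m ++ l :: v) (by simp) hik le_rfl
          rw [List.append_assoc]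
          exact cons_sublist_append this (List.Sublist.cons_cons k (sublist_append_of_right
            (by simp)))
    refine mark (select k i) ?_ (not_alternating_five_right ?_ ?_)
    · have h1 : [false, true, false].Sublist (u.filterMap (select k i)) := by
        simpa [select_right hik', select_left] using hu.filterMap (select k i)
      have h2 : [false].Sublist (v.filterMap (select k i)) := by
        simpa [select_right hik'] using (List.singleton_sublist.2 hiv).filterMap (select k i)
      exact h1.append (h2.cons_cons true)
    · intro hsub
      have hsub : [k, i].Sublist u' := by simpa using sublist_of_select hsub
      obtain ⟨X₁, X₂, rfl, hX₁, hX₂⟩ := List.cons_sublist_iff.1 hsub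
      rw [List.singleton_sublist] at hX₂
      obtain ⟨Z₁, Z₂, rfl⟩ := List.append_of_mem hX₂
      have e2 : X₁ ++ (Z₁ ++ i :: Z₂) ++ l :: v' = (X₁ ++ Z₁) ++ i :: (Z₂ ++ l :: v') := by simp
      rw [e2] at hQ ht
      -- every `0` would have to precede this occurrence of `i`
      have h0 : 0 ∉ Z₂ ++ l :: v' := fun h0 => hQ (cons_sublist_append
        (List.mem_append_left _ hX₁) (List.Sublist.cons_cons i (by simpa using h0)))
      have h3 : [0, i, 0].Sublist (X₁ ++ Z₁) :=
        concat_sublist_of_notMem (p := [0, i]) (B := i :: (Z₂ ++ l :: v'))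
          (by rw [List.mem_cons, not_or]; exact ⟨hi.ne, h0⟩)
          ((List.sublist_append_left [0, i, 0] [i]).trans (ht.sublist hi hik.le))
      refine ht.not_sublist (x := 0) (x' := l) (y := i) (y' := i) hi hi hlt hlt ?_
      exact List.Sublist.append (l₁ := [i, 0]) ((List.sublist_cons_self 0 _).trans h3)
        (List.Sublist.cons_cons i (by simp))
    · intro hsub
      have hsub : [i, k, i].Sublist v' := by simpa using sublist_of_select hsub
      exact ht.not_sublist hik hik hik hik (cons_sublist_append hk_t (hsub.cons l))

/-- If `θ s` has the full descending part `k - 1, …, 1` between an occurrence of `k` and an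
occurrence of `0`, and `s` has fewer than `k - 2` variables (ensured by bounding its length), then
an identity `s ≈ t` cannot destroy it. -/
theorem PropertyC.sublist_flatMap (hC : PropertyC 4 M) {s t : List V} (hst : ListIdentity M s t)
    (hcard : s.length + 2 < k) (θ : V → List ℕ) (hs : IsTyped k (s.flatMap θ))
    (ht : IsTyped k (t.flatMap θ))
    (hP : ∀ i, 0 < i → i < k → [k, i, 0].Sublist (s.flatMap θ)) :
    ∀ i, 0 < i → i < k → [k, i, 0].Sublist (t.flatMap θ) := by
  intro i hi hik
  have : Nonempty V := ⟨(exists_covers (hP i hi hik)).choose⟩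
  choose! h s₁ s₂ α β c using fun l (hl : 0 < l ∧ l < k) => exists_covers (hP l hl.1 hl.2)
  have hpigeon : s.toFinset.card < ((Finset.Ioo 0 k).erase i).card := by
    rw [Finset.card_erase_of_mem (by simp [hi, hik]), Nat.card_Ioo]
    have := List.toFinset_card_le s
    omega
  obtain ⟨l, hl, l', hl', hne, hh⟩ := Finset.exists_ne_map_eq_of_card_lt_of_maps_to hpigeon
    (f := h) (fun l hl => by
      have hl := Finset.mem_coe.1 hl
      simp only [Finset.mem_erase, Finset.mem_Ioo] at hl
      have e := (c l hl.2).eq_append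
      simp only [Finset.mem_coe, List.mem_toFinset]
      rw [e]; simp)
  simp only [Finset.mem_erase, Finset.mem_Ioo] at hl hl'
  wlog hll : l < l' generalizing l l'
  · exact this l' l hne.symm hh.symm hl' hl (by omega)
  have cl := c l hl.2
  have cl' := c l' hl'.2
  rw [← hh] at cl'
  obtain ⟨hs₁, hs₂, hα⟩ := hs.linear_of_covers hl.2.1 hll hl'.2.2 cl cl'
  have es := cl.eq_append
  have hcount : s.count (h l) = 1 := by
    rw [es, List.count_append, List.count_cons_self, List.count_eq_zero_of_not_mem hs₁,
      List.count_eq_zero_of_not_mem hs₂]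
  have hcount' := hC.count_eq_one hst hcount
  obtain ⟨t₁, t₂, et⟩ := List.append_of_mem (List.count_pos_iff.1 (by omega : 0 < t.count (h l)))
  rw [et, List.count_append, List.count_cons_self] at hcount'
  have ht₁ : h l ∉ t₁ := List.count_eq_zero.1 (by omega)
  have ht₂ : h l ∉ t₂ := List.count_eq_zero.1 (by omega)
  have hPi := hP i hi hik
  rw [es] at hst hs hPi cl
  rw [et] at hst ht ⊢
  exact hC.sublist_of_linear hst hs ht hs₁ hs₂ ht₁ ht₂ hl.2.1 hll hl'.2.2 hi hik hl.1.symm cl hα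
    hPi

end Step

/-! ### Deductions from identities with few variables -/

section Deduction

variable {M : Type*} [Monoid M] {B : Set (Word × Word)}

lemma Deducible.listIdentity (hB : ∀ p ∈ B, Satisfies M p.1 p.2) {u v : Word}
    (h : Deducible B u v) : ListIdentity M (letters u) (letters v) := by
  induction h with
  | subst u v h θ =>
    rw [letters_lift, letters_lift]
    exact ((satisfies_iff _ _).1 (hB _ h)).flatMap _
  | refl u => exact ListIdentity.refl _
  | symm _ ih => exact ih.symm
  | trans _ _ ih ih' => exact ih.trans ih'
  | mul _ _ ih ih' => rw [letters_mul, letters_mul]; exact ih.append ih'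

/-- The word `s` between two new variables. -/
def frame (s : List ℕ) : List ℕ := 0 :: (s.map (· + 2) ++ [1])

/-- The substitution that sends the two new variables of `frame s` to `a` and `b`. -/
def frameSubst (a b : List ℕ) (θ : ℕ → List ℕ) : ℕ → List ℕ
  | 0 => a
  | 1 => b
  | i + 2 => θ i

lemma flatMap_frame (a b : List ℕ) (θ : ℕ → List ℕ) (s : List ℕ) :
    (frame s).flatMap (frameSubst a b θ) = a ++ (s.flatMap θ ++ b) := by
  simp [frame, frameSubst, List.flatMap_map]

/-- One application of an identity with few variables, inside a context `a _ b`. The context is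
absorbed into the identity by means of two new variables. -/
lemma PropertyC.sublist_context (hC : PropertyC 4 M) {k : ℕ} {s t : List ℕ}
    (hst : ListIdentity M s t) (hcard : s.length + 4 < k) (θ : ℕ → List ℕ) (a b : List ℕ)
    (hU : ListIdentity M (letters (wordU k)) (a ++ (s.flatMap θ ++ b)))
    (hP : ∀ i, 0 < i → i < k → [k, i, 0].Sublist (a ++ (s.flatMap θ ++ b))) :
    ∀ i, 0 < i → i < k → [k, i, 0].Sublist (a ++ (t.flatMap θ ++ b)) := by
  have hframe : ListIdentity M (frame s) (frame t) :=
    (ListIdentity.refl [0]).append ((hst.map (· + 2)).append (ListIdentity.refl [1]))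
  have hU' := hU.trans
    ((ListIdentity.refl a).append ((hst.flatMap θ).append (ListIdentity.refl b)))
  have hs := hC.isTyped hU
  have ht := hC.isTyped hU'
  rw [← flatMap_frame] at hs ht hP ⊢
  exact hC.sublist_flatMap hframe (by simp [frame]; omega) _ hs ht hP

/-- The descending part of a word forming an identity with `U_n` is invariant under deductions from
identities that are short compared with `n = k + 1`. -/
lemma Deducible.sublist_iff (hC : PropertyC 4 M) (hB : ∀ p ∈ B, Satisfies M p.1 p.2) {k : ℕ}
    (hk : ∀ p ∈ B, (letters p.1).length + 4 < k ∧ (letters p.2).length + 4 < k) {u v : Word}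
    (h : Deducible B u v) : ∀ a b : List ℕ,
      ListIdentity M (letters (wordU k)) (a ++ (letters u ++ b)) →
      ((∀ i, 0 < i → i < k → [k, i, 0].Sublist (a ++ (letters u ++ b))) ↔
        ∀ i, 0 < i → i < k → [k, i, 0].Sublist (a ++ (letters v ++ b))) := by
  have move : ∀ {u v : Word}, Deducible B u v → ∀ a b : List ℕ,
      ListIdentity M (a ++ (letters u ++ b)) (a ++ (letters v ++ b)) := fun h a b =>
    (ListIdentity.refl a).append ((h.listIdentity hB).append (ListIdentity.refl b))
  induction h with
  | subst u v h θ =>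
    intro a b hU
    have hU' := hU.trans (move (.subst u v h θ) a b)
    have hid := (satisfies_iff _ _).1 (hB _ h)
    rw [letters_lift] at hU hU' ⊢
    rw [letters_lift]
    exact ⟨hC.sublist_context hid (hk _ h).1 _ a b hU,
      hC.sublist_context hid.symm (hk _ h).2 _ a b hU'⟩
  | refl u => intro a b _; exact Iff.rfl
  | symm h ih => intro a b hU; exact (ih a b (hU.trans (move h.symm a b))).symm
  | trans h _ ih ih' =>
    intro a b hU
    exact (ih a b hU).trans (ih' a b (hU.trans (move h a b)))
  | @mul u v u' v' h h' ih ih' =>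
    intro a b hU
    simp only [letters_mul, List.append_assoc] at hU ⊢
    have h1 := ih a (letters u' ++ b) hU
    have hU' := hU.trans (move h a (letters u' ++ b))
    have h2 := ih' (a ++ letters v) b (by simpa using hU')
    simp only [List.append_assoc] at h2
    exact h1.trans h2

end Deduction

lemma sublist_letters_wordU {k i : ℕ} (hi : 0 < i) (hik : i < k) :
    [k, i, 0].Sublist (letters (wordU k)) := by
  rw [letters_wordU]
  refine cons_sublist_append (by simp) (.trans ?_ (List.sublist_append_left _ _))
  have h : [0, i].Sublist (List.range (k + 1)) := by
    rw [List.range_succ_eq_map]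
    exact List.Sublist.cons_cons 0 (by simp; exact ⟨i - 1, by omega, by omega⟩)
  simpa using h.reverse

lemma not_sublist_letters_wordV {k : ℕ} (hk : 1 < k) : ¬ [k, 1, 0].Sublist (letters (wordV k)) := by
  rw [wordV, letters_mul, letters_ascending]
  intro h
  rcases sublist_or_sublist_of_append (a := [k]) (b := [0]) h with h | h
  · have := List.pairwise_lt_range.sublist h
    simp at this; omega
  · have := (pairwise_letters_squares k).1.sublist h
    simp at this

end MonoidIdentities

theorem theorem1p1 {M : Type*} [Monoid M]
    (hC : MonoidIdentities.PropertyC 4 M)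
    (hUV : ∀ k : ℕ,
      MonoidIdentities.Satisfies M (MonoidIdentities.wordU k) (MonoidIdentities.wordV k)) :
    ¬ MonoidIdentities.FinitelyBased M := by
  open MonoidIdentities in
  rintro ⟨B, hfin, hB, hded⟩
  obtain ⟨N, hN⟩ := (hfin.image fun p => (letters p.1).length + (letters p.2).length).bddAbove
  have hk : ∀ p ∈ B, (letters p.1).length + 4 < N + 5 ∧ (letters p.2).length + 4 < N + 5 := by
    intro p hp
    have : (letters p.1).length + (letters p.2).length ≤ N := hN (Set.mem_image_of_mem _ hp)
    omega
  have key := (hded _ _ (hUV (N + 5))).sublist_iff hC hB hk [] []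
  simp only [List.nil_append, List.append_nil] at key
  exact not_sublist_letters_wordV (by omega)
    ((key (ListIdentity.refl _)).1 (fun i => sublist_letters_wordU) 1 (by omega) (by omega))
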